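/- Consider an urn with white and blue balls and replacement matrix $\begin{pmatrix}-a&-a\\ a&a\end{pmatrix}$, $a\ge 1$ an integer: when a white ball is drawn it is returned and $a$ balls of each color are removed; when a blue ball is drawn it is returned and $a$ balls of each color are added. The urn starts from given numbers $W(0)$ and $B(0)$ of white and blue balls, with differential index $\Delta:=B(0)-W(0)\ge 1$, and it is tenable, that is, on every possible path of draws the urn never becomes empty and always holds enough balls for the required removals. The urn is embedded in continuous time: every ball carries an $\mathrm{Exp}(1)$ clock, all clocks being independent of each other and of the past (so that, by memorylessness, after every epoch the clocks of all the balls then present are again independent $\mathrm{Exp}(1)$); when a clock rings, its ball is drawn and the replacement is made at once. Let $W(t)$ be the number of white balls at time $t$. Then, for every $t>0$, $W(t)/t-a\Delta$ is integrable and $$\mathbb E\left|\frac{W(t)}{t}-a\Delta\right|\le\sqrt{a^3\Delta+\frac{a^2\,(W(0)+\Delta)}{t}}+\frac{W(0)}{t}.$$ In particular, $\mathbb E\,|W(t)/t-a\Delta|$ is bounded as $t\to\infty$: there are finite $M$ and $t_0$ with $\mathbb E\,|W(t)/t-a\Delta|\le M$ for all $t\ge t_0$. -/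

import Mathlib

open MeasureTheory ProbabilityTheory Filter
open scoped NNReal ENNReal

noncomputable section

namespace PolyaUrn

/-- The composition of a two-color urn: coordinate `0` is the number of white balls,
coordinate `1` the number of blue balls. -/
abbrev Comp : Type := Fin 2 → ℤ

/-- The replacement matrix of the constant-differentials urn. Row `i` is what is added to the
urn when a ball of color `i` is drawn. -/
def constDiffMatrix (a : ℕ) : Matrix (Fin 2) (Fin 2) ℤ :=
  !![-(a : ℤ), -(a : ℤ); (a : ℤ), (a : ℤ)]

/-- The compositions that can be reached from `x₀`: a color can be drawn only if a ball of that
color is present. -/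
inductive Reachable (A : Matrix (Fin 2) (Fin 2) ℤ) (x₀ : Comp) : Comp → Prop
  | start : Reachable A x₀ x₀
  | draw (x : Comp) (i : Fin 2) (hx : Reachable A x₀ x) (hi : 0 < x i) :
      Reachable A x₀ (x + A i)

/-- The urn is tenable: on every path the urn never becomes empty and never has to give up more
balls of a color than it holds. -/
def Tenable (A : Matrix (Fin 2) (Fin 2) ℤ) (x₀ : Comp) : Prop :=
  ∀ x, Reachable A x₀ x → (∀ i, 0 ≤ x i) ∧ ∃ i, 0 < x i

/-- The balls in an urn of composition `x`; the first component of a ball is its color. -/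
abbrev Ball (x : Comp) : Type := (i : Fin 2) × Fin (x i).toNat

/-- Every ball in an urn of composition `x` carries an `Exp(1)` clock, and the clocks are
independent. This is the probability that the first clock to ring belongs to a ball of color `i`
and rings after time `s`. -/
def firstRing (x : Comp) (i : Fin 2) (s : ℝ) : ℝ≥0∞ :=
  (Measure.pi fun _ : Ball x => expMeasure 1)
    {k | ∃ β : Ball x, β.1 = i ∧ s < k β ∧ ∀ γ : Ball x, k β ≤ k γ}

variable {Ω : Type*}

/-- The composition after the first `n` draws, when `C j` is the color of draw number `j`. -/
def compAfter (A : Matrix (Fin 2) (Fin 2) ℤ) (x₀ : Comp) (C : ℕ → Ω → Fin 2) (n : ℕ) (ω : Ω) :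
    Comp :=
  x₀ + ∑ j ∈ Finset.range n, A (C j ω)

/-- The epoch (time) of the `n`-th draw, when `H j` are the interarrival times; the `0`-th epoch
is time `0`. -/
def epoch (H : ℕ → Ω → ℝ) (n : ℕ) (ω : Ω) : ℝ := ∑ j ∈ Finset.range n, H j ω

/-- The sigma-algebra generated by the first `n` draws and interarrival times. -/
abbrev past (C : ℕ → Ω → Fin 2) (H : ℕ → Ω → ℝ) (n : ℕ) : MeasurableSpace Ω :=
  MeasurableSpace.comap (fun ω (j : Fin n) => (C j ω, H j ω)) inferInstance

/-- `X` is the urn process driven by the drawn colors `C` and the interarrival times `H`. -/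
structure IsDrivenBy [MeasurableSpace Ω] (A : Matrix (Fin 2) (Fin 2) ℤ) (x₀ : Comp)
    (μ : Measure Ω) (C : ℕ → Ω → Fin 2) (H : ℕ → Ω → ℝ) (X : ℝ≥0 → Ω → Comp) : Prop where
  measurable_color : ∀ n, Measurable (C n)
  measurable_interarrival : ∀ n, Measurable (H n)
  measurable_process : ∀ t, Measurable (X t)
  /-- Given the past up to the `n`-th epoch, the next draw is decided by independent `Exp(1)`
  clocks on the balls that are then in the urn. -/
  next_draw : ∀ (n : ℕ) (E : Set Ω), MeasurableSet[past C H n] E → ∀ (i : Fin 2) (s : ℝ),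
    μ (E ∩ {ω | C n ω = i ∧ s < H n ω}) = ∫⁻ ω in E, firstRing (compAfter A x₀ C n ω) i s ∂μ
  /-- The composition is constant between consecutive epochs. -/
  path : ∀ᵐ ω ∂μ, ∀ (n : ℕ) (t : ℝ≥0),
    epoch H n ω ≤ t → (t : ℝ) < epoch H (n + 1) ω → X t ω = compAfter A x₀ C n ω

/-- `X` is a Pólya process with replacement matrix `A` and initial composition `x₀`. -/
def IsPolyaProcess [MeasurableSpace Ω] (A : Matrix (Fin 2) (Fin 2) ℤ) (x₀ : Comp)
    (μ : Measure Ω) (X : ℝ≥0 → Ω → Comp) : Prop :=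
  ∃ (C : ℕ → Ω → Fin 2) (H : ℕ → Ω → ℝ), IsDrivenBy A x₀ μ C H X

end PolyaUrn

end

namespace PolyaUrn

open Set

/-! Every draw changes both colors equally, so `B - W = Δ` forever and the white count `w` is a
Markov chain: up by `a` at rate `w + Δ`, down by `a` at rate `w`. Its drift is the constant `aΔ` and
its variance rate `a²(2w + Δ)` is affine in `w`, so the first two moments are explicit polynomials
in time. They enter as nonnegative solutions `g` of the backward equation. Stopping at the first
epoch turns that equation into a one-step identity (`lintegral_step`); telescoping it along the
epochs bounds the mean terminal value by `g` at time 0. Nonnegativity removes all integrability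
questions, and the solution that counts draws rules out explosion. For `a ≤ 4Δ` the second moment
and Jensen give the bound; for `a ≥ 4Δ` the triangle inequality and the mean suffice. -/

/-! ### The law of the first ring among independent exponential clocks. -/

lemma expMeasure_one_eq_withDensity :
    expMeasure 1 = (volume.restrict (Ioi (0 : ℝ))).withDensity
      (fun u => ENNReal.ofReal (Real.exp (-u))) := by
  have h : exponentialPDF 1 = (Ici (0 : ℝ)).indicator
      (fun u => ENNReal.ofReal (Real.exp (-u))) := by
    ext u
    rw [exponentialPDF_eq]
    by_cases hu : 0 ≤ u <;> simp [hu]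
  have h' : expMeasure 1 = volume.withDensity (exponentialPDF 1) := rfl
  rw [h', h, withDensity_indicator measurableSet_Ici,
    Measure.restrict_congr_set Ioi_ae_eq_Ici]

lemma expMeasure_one_Ioi {u : ℝ} (hu : 0 ≤ u) :
    expMeasure 1 (Ioi u) = ENNReal.ofReal (Real.exp (-u)) := by
  have := isProbabilityMeasure_expMeasure one_pos
  rw [← compl_Iic, prob_compl_eq_one_sub measurableSet_Iic, ← ofReal_cdf,
    cdf_expMeasure_eq one_pos, if_pos hu, ← ENNReal.ofReal_one,
    ← ENNReal.ofReal_sub _ (by simpa using hu)]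
  simp

lemma expMeasure_one_Ici {u : ℝ} (hu : 0 ≤ u) :
    expMeasure 1 (Ici u) = ENNReal.ofReal (Real.exp (-u)) := by
  rw [← expMeasure_one_Ioi hu, ← Ioi_union_left]
  refine le_antisymm ((measure_union_le _ _).trans ?_) (measure_mono subset_union_left)
  have : expMeasure 1 {u} = 0 := by
    rw [expMeasure_one_eq_withDensity]
    exact withDensity_absolutelyContinuous _ _ (by simp)
  simp [this]

/-- The law of the first ring time of an urn of composition `x`, on the event that the ball whose
clock rings first has color `i`. -/
noncomputable def ringMeasure (x : Comp) (i : Fin 2) : Measure ℝ :=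
  (volume.restrict (Ioi (0 : ℝ))).withDensity fun h =>
    ENNReal.ofReal ((x i).toNat * Real.exp (-(((x 0).toNat + (x 1).toNat : ℝ) * h)))

/-- Fubini after separating clock `β` from the others: given that `β` rings at `u`, each other clock
contributes a factor `exp (-u)`. Leaving `R` free covers both strict and weak minimality of `β`. -/
lemma pi_expMeasure_first {ι : Type*} [Fintype ι] (β : ι) (s : ℝ)
    (R : ℝ → Set ℝ) (hR : MeasurableSet {p : ℝ × ℝ | p.2 ∈ R p.1})
    (hexp : ∀ u, 0 ≤ u → expMeasure 1 (R u) = ENNReal.ofReal (Real.exp (-u))) :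
    (Measure.pi fun _ : ι => expMeasure 1) {k | s < k β ∧ ∀ γ, γ ≠ β → k γ ∈ R (k β)} =
      ∫⁻ u in Ioi 0 ∩ Ioi s, ENNReal.ofReal (Real.exp (-(Fintype.card ι * u))) := by
  classical
  have hprob := isProbabilityMeasure_expMeasure one_pos
  have h1 := measurePreserving_piEquivPiSubtypeProd (fun _ : ι => expMeasure 1) (fun γ => γ = β)
  have h2 := (measurePreserving_funUnique (expMeasure 1) {γ : ι // γ = β}).prod
    (MeasurePreserving.id (Measure.pi fun _ : {γ : ι // ¬ γ = β} => expMeasure 1))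
  have h3 := h2.comp (by convert h1)
  set S : Set (ℝ × ({γ : ι // ¬ γ = β} → ℝ)) := {q | s < q.1 ∧ ∀ γ, q.2 γ ∈ R q.1} with hS
  have hSm : MeasurableSet S := by
    have hS' : S = {q | s < q.1} ∩ ⋂ γ, {q | q.2 γ ∈ R q.1} := by
      ext q; simp [hS]
    rw [hS']
    refine (measurableSet_lt measurable_const measurable_fst).inter
      (MeasurableSet.iInter fun γ => ?_)
    have : Measurable fun q : ℝ × ({γ : ι // ¬ γ = β} → ℝ) => (q.1, q.2 γ) := by fun_prop
    exact this hR
  have hpre : {k : ι → ℝ | s < k β ∧ ∀ γ, γ ≠ β → k γ ∈ R (k β)} =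
      (Prod.map (MeasurableEquiv.funUnique {γ : ι // γ = β} ℝ) id ∘
        MeasurableEquiv.piEquivPiSubtypeProd (fun _ : ι => ℝ) (fun γ => γ = β)) ⁻¹' S := by
    ext k
    simp [hS, MeasurableEquiv.piEquivPiSubtypeProd, Equiv.piEquivPiSubtypeProd,
      MeasurableEquiv.funUnique]
    rfl
  rw [hpre, h3.measure_preimage hSm.nullMeasurableSet, Measure.prod_apply hSm]
  have hcard : 0 < Fintype.card ι := Fintype.card_pos_iff.2 ⟨β⟩
  have key : ∀ u, 0 < u → (Measure.pi fun _ : {γ : ι // ¬ γ = β} => expMeasure 1)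
      (Prod.mk u ⁻¹' S) = (Ioi s).indicator
        (fun u => ENNReal.ofReal (Real.exp (-((Fintype.card ι - 1 : ℝ) * u)))) u := by
    intro u hu
    by_cases hs : s < u
    · have : Prod.mk u ⁻¹' S = univ.pi fun _ => R u := by
        ext k; simp [hS, hs]
      rw [this, Measure.pi_pi, indicator_of_mem (mem_Ioi.2 hs)]
      simp only [hexp u hu.le, Finset.prod_const, Finset.card_univ, Fintype.card_subtype_compl,
        Fintype.card_unique]
      rw [← ENNReal.ofReal_pow (Real.exp_pos _).le, ← Real.exp_nat_mul, Nat.cast_sub hcard]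
      congr 2
      push_cast
      ring
    · have : Prod.mk u ⁻¹' S = ∅ := by
        ext k; simp [hS, hs]
      simp [this, hs]
  have hm : Measurable fun u : ℝ =>
      ENNReal.ofReal (Real.exp (-((Fintype.card ι - 1 : ℝ) * u))) := by fun_prop
  have hm' : Measurable fun u : ℝ => ENNReal.ofReal (Real.exp (-u)) := by fun_prop
  rw [show (∫⁻ u, (Measure.pi fun _ : {γ : ι // ¬ γ = β} => expMeasure 1)
      (Prod.mk u ⁻¹' S) ∂(expMeasure 1)) = ∫⁻ u, (Ioi s).indicator
        (fun u => ENNReal.ofReal (Real.exp (-((Fintype.card ι - 1 : ℝ) * u)))) u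
          ∂(expMeasure 1) from lintegral_congr_ae ?_]
  · rw [expMeasure_one_eq_withDensity,
      lintegral_withDensity_eq_lintegral_mul _ hm' (hm.indicator measurableSet_Ioi)]
    rw [show ((fun u : ℝ => ENNReal.ofReal (Real.exp (-u))) * (Ioi s).indicator
        (fun u => ENNReal.ofReal (Real.exp (-((Fintype.card ι - 1 : ℝ) * u))))) =
        (Ioi s).indicator (fun u => ENNReal.ofReal (Real.exp (-(Fintype.card ι * u)))) from ?_,
      lintegral_indicator measurableSet_Ioi, Measure.restrict_restrict measurableSet_Ioi,
      inter_comm]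
    ext u
    rw [Pi.mul_apply]
    by_cases hs : s < u
    · simp only [mem_Ioi, hs, indicator_of_mem]
      rw [← ENNReal.ofReal_mul (Real.exp_pos _).le, ← Real.exp_add]
      congr 2; ring
    · simp [hs]
  · have hac : expMeasure 1 ≪ volume.restrict (Ioi (0 : ℝ)) := by
      rw [expMeasure_one_eq_withDensity]
      exact withDensity_absolutelyContinuous _ _
    refine hac.ae_le ?_
    filter_upwards [ae_restrict_mem measurableSet_Ioi] with u hu using key u hu

/-- Ties make the events "ball `β` rings first" overlap. The weak-minimum events cover the ring
event, the strict ones are disjoint inside it, and both have the same probabilities, so the upper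
and lower bounds agree. -/
lemma firstRing_eq_ringMeasure (x : Comp) (i : Fin 2) (s : ℝ) :
    firstRing x i s = ringMeasure x i (Ioi s) := by
  classical
  have hgt := fun β : Ball x => pi_expMeasure_first β s Ioi
    (measurableSet_lt measurable_fst measurable_snd) fun u hu => expMeasure_one_Ioi hu
  have hge := fun β : Ball x => pi_expMeasure_first β s Ici
    (measurableSet_le measurable_fst measurable_snd) fun u hu => expMeasure_one_Ici hu
  have hcard : (Fintype.card (Ball x) : ℝ) = (x 0).toNat + (x 1).toNat := by
    simp [Ball, Fintype.card_sigma, Fin.sum_univ_two]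
  simp only [hcard] at hgt hge
  set I := ∫⁻ u in Ioi 0 ∩ Ioi s,
    ENNReal.ofReal (Real.exp (-(((x 0).toNat + (x 1).toNat : ℝ) * u))) with hI
  set F : Finset (Ball x) := Finset.univ.filter fun β => β.1 = i with hF
  have hFcard : F.card = (x i).toNat := by
    have : F = Finset.univ.map ⟨fun j : Fin (x i).toNat => (⟨i, j⟩ : Ball x),
        fun j k h => by simpa using h⟩ := by
      ext ⟨c, j⟩
      simp only [hF, Finset.mem_filter, Finset.mem_univ, true_and, Finset.mem_map]
      constructor
      · rintro rfl; exact ⟨j, rfl⟩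
      · rintro ⟨k, hk⟩; exact (congrArg Sigma.fst hk).symm
    rw [this, Finset.card_map, Finset.card_univ, Fintype.card_fin]
  have hring : ringMeasure x i (Ioi s) = (x i).toNat * I := by
    rw [ringMeasure, withDensity_apply _ measurableSet_Ioi,
      Measure.restrict_restrict measurableSet_Ioi, inter_comm, hI,
      ← lintegral_const_mul _ (by fun_prop)]
    refine lintegral_congr fun u => ?_
    rw [ENNReal.ofReal_mul (by positivity), ENNReal.ofReal_natCast]
  have hsum : ∑ _β ∈ F, I = (x i).toNat * I := by simp [hFcard]
  rw [hring, ← hsum]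
  apply le_antisymm
  · refine (Finset.sum_congr rfl fun β _ => hge β).symm.ge.trans' ?_
    refine (measure_mono ?_).trans (measure_biUnion_finset_le F _)
    rintro k ⟨β, hβ, hs, hmin⟩
    simp only [mem_iUnion, hF, Finset.mem_filter, Finset.mem_univ, true_and]
    exact ⟨β, hβ, hs, fun γ _ => hmin γ⟩
  · rw [← Finset.sum_congr rfl fun β _ => hgt β, ← measure_biUnion_finset]
    · refine measure_mono ?_
      intro k hk
      simp only [mem_iUnion, hF, Finset.mem_filter, Finset.mem_univ, true_and] at hk
      obtain ⟨β, hβ, hs, hmin⟩ := hk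
      refine ⟨β, hβ, hs, fun γ => ?_⟩
      by_cases h : γ = β
      · rw [h]
      · exact (hmin γ h).le
    · intro β _ γ _ hne
      refine disjoint_left.2 fun k hk hk' => ?_
      exact lt_asymm (mem_Ioi.1 (hk.2 γ hne.symm)) (mem_Ioi.1 (hk'.2 β hne))
    · intro β _
      have hset : {k : Ball x → ℝ | s < k β ∧ ∀ γ, γ ≠ β → k γ ∈ Ioi (k β)} =
          {k | s < k β} ∩ ⋂ γ, ⋂ (_ : γ ≠ β), {k | k β < k γ} := by
        ext k; simp
      rw [hset]
      exact (measurableSet_lt measurable_const (measurable_pi_apply β)).inter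
        (MeasurableSet.iInter fun γ => MeasurableSet.iInter fun _ =>
          measurableSet_lt (measurable_pi_apply β) (measurable_pi_apply γ))

instance isFiniteMeasure_ringMeasure (x : Comp) (i : Fin 2) :
    IsFiniteMeasure (ringMeasure x i) := by
  have hprob := isProbabilityMeasure_expMeasure one_pos
  have h0 : ringMeasure x i (Iic 0) = 0 := by
    refine withDensity_absolutelyContinuous _ _ ?_
    rw [Measure.restrict_apply measurableSet_Iic, Iic_inter_Ioi, Ioc_self, measure_empty]
  have h1 : ringMeasure x i (Ioi 0) ≤ 1 := by
    rw [← firstRing_eq_ringMeasure]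
    exact prob_le_one
  refine ⟨?_⟩
  rw [← Iic_union_Ioi (a := (0 : ℝ))]
  refine (measure_union_le _ _).trans_lt ?_
  rw [h0, zero_add]
  exact h1.trans_lt ENNReal.one_lt_top

lemma lintegral_ringMeasure (x : Comp) (i : Fin 2) {f : ℝ → ℝ≥0∞} (hf : Measurable f) :
    ∫⁻ h, f h ∂(ringMeasure x i) = ∫⁻ h in Ioi 0, ENNReal.ofReal ((x i).toNat *
      Real.exp (-(((x 0).toNat + (x 1).toNat : ℝ) * h))) * f h :=
  lintegral_withDensity_eq_lintegral_mul _ (by fun_prop) hf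

lemma ringMeasure_of_nonpos {x : Comp} {i : Fin 2} (hi : x i ≤ 0) : ringMeasure x i = 0 := by
  simp [ringMeasure, Int.toNat_of_nonpos hi]

/-! ### Conditioning on the past at an epoch. -/

section DrivenProcess

variable {Ω : Type*} {A : Matrix (Fin 2) (Fin 2) ℤ} {x₀ : Comp} {C : ℕ → Ω → Fin 2}
  {H : ℕ → Ω → ℝ}

lemma measurable_past (n : ℕ) {j : ℕ} (hj : j < n) :
    Measurable[past C H n] fun ω => (C j ω, H j ω) :=
  (measurable_pi_apply (⟨j, hj⟩ : Fin n)).comp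
    (comap_measurable fun ω (j : Fin n) => (C j ω, H j ω))

lemma measurable_past_compAfter (n : ℕ) : Measurable[past C H n] (compAfter A x₀ C n) := by
  refine Measurable.const_add (Finset.measurable_sum _ fun j hj => ?_) _
  exact (measurable_of_countable fun c : Fin 2 => A c).comp
    (measurable_fst.comp (measurable_past n (Finset.mem_range.1 hj)))

lemma measurable_past_epoch (n : ℕ) : Measurable[past C H n] (epoch H n) :=
  Finset.measurable_sum _ fun _ hj =>
    measurable_snd.comp (measurable_past n (Finset.mem_range.1 hj))

lemma compAfter_succ (n : ℕ) (ω : Ω) :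
    compAfter A x₀ C (n + 1) ω = compAfter A x₀ C n ω + A (C n ω) := by
  simp only [compAfter, Finset.sum_range_succ, add_assoc]

lemma epoch_succ (n : ℕ) (ω : Ω) : epoch H (n + 1) ω = epoch H n ω + H n ω :=
  Finset.sum_range_succ _ _

variable [MeasurableSpace Ω] {μ : Measure Ω} {X : ℝ≥0 → Ω → Comp}

namespace IsDrivenBy

lemma past_le (hX : IsDrivenBy A x₀ μ C H X) (n : ℕ) : past C H n ≤ ‹MeasurableSpace Ω› :=
  (measurable_pi_lambda _ fun j : Fin n =>
    (hX.measurable_color j).prodMk (hX.measurable_interarrival j)).comap_le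

lemma measurable_compAfter (hX : IsDrivenBy A x₀ μ C H X) (n : ℕ) :
    Measurable (compAfter A x₀ C n) :=
  (measurable_past_compAfter n).mono (hX.past_le n) le_rfl

lemma measurable_epoch (hX : IsDrivenBy A x₀ μ C H X) (n : ℕ) : Measurable (epoch H n) :=
  (measurable_past_epoch n).mono (hX.past_le n) le_rfl

/-- On the event that the composition after `n` draws is `z`, the next draw is independent of the
`n`-th epoch. -/
lemma map_epoch_interarrival [IsFiniteMeasure μ] (hX : IsDrivenBy A x₀ μ C H X) (n : ℕ)
    (z : Comp) (i : Fin 2) :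
    (μ.restrict ({ω | compAfter A x₀ C n ω = z} ∩ {ω | C n ω = i})).map
        (fun ω => (epoch H n ω, H n ω)) =
      ((μ.restrict {ω | compAfter A x₀ C n ω = z}).map (epoch H n)).prod (ringMeasure z i) := by
  have hT := hX.measurable_epoch n
  have hH := hX.measurable_interarrival n
  have hz : MeasurableSet[past C H n] {ω | compAfter A x₀ C n ω = z} :=
    measurable_past_compAfter n (measurableSet_singleton z)
  symm
  -- `next_draw` only prescribes the tails `s < H n`; the half-lines `Ioi s` form a generating
  -- π-system, which is enough to identify the product measure.
  refine Measure.prod_eq_generateFrom (C := {s | MeasurableSet s}) (D := range Ioi)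
    MeasurableSpace.generateFrom_measurableSet
    ((borel_eq_generateFrom_Ioi ℝ).symm.trans BorelSpace.measurable_eq.symm)
    MeasurableSpace.isPiSystem_measurableSet isPiSystem_Ioi
    (Measure.toFiniteSpanningSetsIn _)
    ⟨fun k => Ioi (-(k : ℝ)), fun k => mem_range_self _, fun k => measure_lt_top _ _, ?_⟩ ?_
  · refine eq_univ_of_forall fun u => ?_
    obtain ⟨k, hk⟩ := exists_nat_gt (-u)
    exact mem_iUnion.2 ⟨k, by simpa using neg_lt.1 hk⟩
  · rintro E (hE : MeasurableSet E) _ ⟨s, rfl⟩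
    have hE' : MeasurableSet[past C H n] (epoch H n ⁻¹' E ∩ {ω | compAfter A x₀ C n ω = z}) :=
      (measurable_past_epoch n hE).inter hz
    have hdraw := hX.next_draw n _ hE' i s
    rw [setLIntegral_congr_fun (g := fun _ => ringMeasure z i (Ioi s)) (hX.past_le n _ hE')
      fun ω hω => by rw [← firstRing_eq_ringMeasure, ← hω.2], setLIntegral_const] at hdraw
    rw [Measure.map_apply (hT.prodMk hH) (hE.prod measurableSet_Ioi),
      Measure.restrict_apply (hT.prodMk hH (hE.prod measurableSet_Ioi)),
      Measure.map_apply hT hE, Measure.restrict_apply (hT hE), mul_comm, ← hdraw]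
    congr 1
    ext ω
    simp only [mem_inter_iff, mem_preimage, mem_prod, mem_Ioi, mem_ofPred_eq]
    tauto

/-- The Markov property at the `n`-th epoch. There are countably many compositions, so it reduces to
the product law on each event where composition and color are fixed. -/
lemma lintegral_draw [IsFiniteMeasure μ] (hX : IsDrivenBy A x₀ μ C H X) (n : ℕ)
    {Φ : Comp → ℝ → Fin 2 → ℝ → ℝ≥0∞}
    (hΦ : ∀ z i, Measurable fun p : ℝ × ℝ => Φ z p.1 i p.2) :
    ∫⁻ ω, Φ (compAfter A x₀ C n ω) (epoch H n ω) (C n ω) (H n ω) ∂μ =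
      ∫⁻ ω, ∑ i, ∫⁻ h, Φ (compAfter A x₀ C n ω) (epoch H n ω) i h
        ∂(ringMeasure (compAfter A x₀ C n ω) i) ∂μ := by
  have hT := hX.measurable_epoch n
  have hH := hX.measurable_interarrival n
  have hzm : ∀ z, MeasurableSet {ω | compAfter A x₀ C n ω = z} := fun z =>
    hX.measurable_compAfter n (measurableSet_singleton z)
  have hcm : ∀ i, MeasurableSet {ω | C n ω = i} := fun i =>
    hX.measurable_color n (measurableSet_singleton i)
  have hpart : ∀ f : Ω → ℝ≥0∞, ∫⁻ ω, f ω ∂μ =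
      ∑' z, ∫⁻ ω in {ω | compAfter A x₀ C n ω = z}, f ω ∂μ := fun f => by
    rw [← lintegral_iUnion hzm, show (⋃ z, {ω | compAfter A x₀ C n ω = z}) = univ from
      eq_univ_of_forall fun ω => mem_iUnion.2 ⟨_, rfl⟩, setLIntegral_univ]
    intro z z' hne
    exact disjoint_left.2 fun ω h h' => hne (h.symm.trans h')
  rw [hpart, hpart]
  refine tsum_congr fun z => ?_
  have hsplit : ∀ f : Ω → ℝ≥0∞, ∫⁻ ω in {ω | compAfter A x₀ C n ω = z}, f ω ∂μ =
      ∑ i, ∫⁻ ω in {ω | compAfter A x₀ C n ω = z} ∩ {ω | C n ω = i}, f ω ∂μ := fun f => by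
    rw [← tsum_fintype (L := .unconditional _),
      ← lintegral_iUnion (fun i => (hzm z).inter (hcm i)), ← inter_iUnion,
      show (⋃ i, {ω | C n ω = i}) = univ from
        eq_univ_of_forall fun ω => mem_iUnion.2 ⟨_, rfl⟩, inter_univ]
    intro i i' hne
    exact disjoint_left.2 fun ω h h' => hne (h.2.symm.trans h'.2)
  rw [hsplit, setLIntegral_congr_fun (g := fun ω => ∑ i, ∫⁻ h, Φ z (epoch H n ω) i h
    ∂(ringMeasure z i)) (hzm z) (fun ω hω => by rw [show compAfter A x₀ C n ω = z from hω]),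
    lintegral_finsetSum]
  · refine Finset.sum_congr rfl fun i _ => ?_
    rw [setLIntegral_congr_fun (g := fun ω => Φ z (epoch H n ω) i (H n ω))
      ((hzm z).inter (hcm i)) (fun ω hω => by
        rw [show compAfter A x₀ C n ω = z from hω.1, show C n ω = i from hω.2]),
      ← lintegral_map (f := fun p : ℝ × ℝ => Φ z p.1 i p.2) (hΦ z i) (hT.prodMk hH),
      hX.map_epoch_interarrival n z i, lintegral_prod _ (hΦ z i).aemeasurable,
      lintegral_map (hΦ z i).lintegral_prod_right' hT]
  · intro i _
    exact (hΦ z i).lintegral_prod_right'.comp hT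

/-- Almost surely only balls that are present are drawn. -/
lemma ae_reachable [IsFiniteMeasure μ] (hX : IsDrivenBy A x₀ μ C H X) (n : ℕ) :
    ∀ᵐ ω ∂μ, Reachable A x₀ (compAfter A x₀ C n ω) := by
  induction n with
  | zero =>
    refine Eventually.of_forall fun ω => ?_
    simpa [compAfter] using Reachable.start
  | succ n ih =>
    have hpos : ∀ᵐ ω ∂μ, 0 < compAfter A x₀ C n ω (C n ω) := by
      have hm : ∀ (z : Comp) (i : Fin 2), Measurable fun _ : ℝ × ℝ =>
          if 0 < z i then (0 : ℝ≥0∞) else 1 := fun z i => measurable_const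
      -- The test function is the indicator of drawing an absent color, to which `ringMeasure` gives
      -- mass zero.
      have h := hX.lintegral_draw n (Φ := fun z _ i _ => if 0 < z i then 0 else 1) hm
      rw [lintegral_congr (g := fun _ => 0) (μ := μ) (f := fun ω => ∑ i, ∫⁻ _,
        (if 0 < compAfter A x₀ C n ω i then 0 else 1)
          ∂(ringMeasure (compAfter A x₀ C n ω) i)), lintegral_zero] at h
      · have hmeas : Measurable fun ω => if 0 < compAfter A x₀ C n ω (C n ω) then
            (0 : ℝ≥0∞) else 1 :=
          (measurable_of_countable fun q : Comp × Fin 2 => if 0 < q.1 q.2 then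
            (0 : ℝ≥0∞) else 1).comp ((hX.measurable_compAfter n).prodMk (hX.measurable_color n))
        filter_upwards [(lintegral_eq_zero_iff hmeas).1 h] with ω hω
        by_contra hc
        simp [hc] at hω
      · intro ω
        refine Finset.sum_eq_zero fun i _ => ?_
        by_cases hi : 0 < compAfter A x₀ C n ω i
        · simp [hi]
        · simp [ringMeasure_of_nonpos (not_lt.1 hi)]
    filter_upwards [ih, hpos] with ω h1 h2
    rw [compAfter_succ]
    exact Reachable.draw _ _ h1 h2

end IsDrivenBy

end DrivenProcess

/-! ### Backward equations and their one-step identity. -/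

lemma lintegral_Ioi_exp_mul {r c u : ℝ} (hr : 0 < r) (hc : 0 ≤ c) :
    ∫⁻ h in Ioi u, ENNReal.ofReal (r * Real.exp (-(r * h)) * c) =
      ENNReal.ofReal (Real.exp (-(r * u)) * c) := by
  have hint : IntegrableOn (fun h => r * Real.exp (-(r * h)) * c) (Ioi u) := by
    simp only [neg_mul_eq_neg_mul]
    exact ((exp_neg_integrableOn_Ioi u hr).const_mul r).mul_const c
  rw [← ofReal_integral_eq_lintegral_ofReal hint
    (Eventually.of_forall fun h => by positivity)]
  congr 1
  rw [integral_mul_const, integral_const_mul]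
  simp only [neg_mul_eq_neg_mul]
  rw [integral_exp_mul_Ioi (by linarith)]
  field_simp

/-- A family `g n s w` of functions of the number of draws `n`, the time `s` and the number of
white balls `w` which solves the backward equation of the urn and is nonnegative before `t`. -/
structure IsBackwardSolution (a : ℕ) (Δ : ℤ) (t : ℝ) (g : ℕ → ℝ → ℝ → ℝ) : Prop where
  hasDerivAt : ∀ n s w, HasDerivAt (fun s => g n s w)
    ((2 * w + Δ) * g n s w - (w + Δ) * g (n + 1) s (w + a) - w * g (n + 1) s (w - a)) s
  nonneg : ∀ n s w, s ≤ t → 0 ≤ w → 0 ≤ g n s w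

namespace IsBackwardSolution

variable {a : ℕ} {Δ : ℤ} {t : ℝ} {g : ℕ → ℝ → ℝ → ℝ}

lemma continuous (hg : IsBackwardSolution a Δ t g) (n : ℕ) (w : ℝ) :
    Continuous fun s => g n s w :=
  continuous_iff_continuousAt.2 fun s => (hg.hasDerivAt n s w).continuousAt

lemma measurable_ite (hg : IsBackwardSolution a Δ t g) (n : ℕ) (v w : ℝ) :
    Measurable fun p : ℝ × ℝ => if p.1 + p.2 ≤ t then ENNReal.ofReal (g (n + 1) (p.1 + p.2) v)
      else if p.1 ≤ t then ENNReal.ofReal (g n t w) else 0 := by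
  have h1 := hg.continuous (n + 1) v
  refine Measurable.ite (measurableSet_le (by fun_prop) measurable_const) ?_
    (Measurable.ite (measurableSet_le (by fun_prop) measurable_const) measurable_const
      measurable_const)
  exact (h1.comp (continuous_fst.add continuous_snd)).measurable.ennreal_ofReal

/-- One step of the urn: the value at time `τ` is the mean of the value after the first ring if
that comes before `t`, and of the terminal value otherwise. -/
lemma lintegral_step (hg : IsBackwardSolution a Δ t g) (n : ℕ) {τ w : ℝ} (hτ : τ ≤ t)
    (hw : 0 ≤ w) (hwa : w = 0 ∨ a ≤ w) (hΔ : 0 < Δ) :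
    (∫⁻ h in Ioi 0, ENNReal.ofReal (w * Real.exp (-((2 * w + Δ) * h))) *
        (if τ + h ≤ t then ENNReal.ofReal (g (n + 1) (τ + h) (w - a))
          else ENNReal.ofReal (g n t w))) +
      (∫⁻ h in Ioi 0, ENNReal.ofReal ((w + Δ) * Real.exp (-((2 * w + Δ) * h))) *
        (if τ + h ≤ t then ENNReal.ofReal (g (n + 1) (τ + h) (w + a))
          else ENNReal.ofReal (g n t w))) = ENNReal.ofReal (g n τ w) := by
  have hΔ' : (0 : ℝ) < Δ := by exact_mod_cast hΔ
  set r : ℝ := 2 * w + Δ with hr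
  have hr0 : 0 < r := by positivity
  have hu : 0 ≤ t - τ := by linarith
  have hc := hg.nonneg n t w le_rfl hw
  have hcont1 : Continuous fun h => g (n + 1) (τ + h) (w - a) :=
    (hg.continuous (n + 1) (w - a)).comp (continuous_const.add continuous_id)
  have hcont2 : Continuous fun h => g (n + 1) (τ + h) (w + a) :=
    (hg.continuous (n + 1) (w + a)).comp (continuous_const.add continuous_id)
  have hset : MeasurableSet {h : ℝ | τ + h ≤ t} :=
    measurableSet_le (by fun_prop) measurable_const
  have hm : ∀ v, Continuous (fun h => g (n + 1) (τ + h) v) → Measurable fun h =>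
      if τ + h ≤ t then ENNReal.ofReal (g (n + 1) (τ + h) v) else ENNReal.ofReal (g n t w) :=
    fun v hv => Measurable.ite hset hv.measurable.ennreal_ofReal measurable_const
  set ψ : ℝ → ℝ := fun h => Real.exp (-(r * h)) *
    ((w + Δ) * g (n + 1) (τ + h) (w + a) + w * g (n + 1) (τ + h) (w - a)) with hψ
  have hψc : Continuous ψ :=
    (by fun_prop : Continuous fun h => Real.exp (-(r * h))).mul
      ((continuous_const.mul hcont2).add (continuous_const.mul hcont1))
  -- At `w = 0` the argument `w - a` may be negative, where `g` is not known to be nonnegative, but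
  -- the rate `w` then vanishes.
  have hnn1 : ∀ h, τ + h ≤ t → 0 ≤ w * g (n + 1) (τ + h) (w - a) := fun h hh => by
    rcases hwa with h0 | h0
    · simp [h0]
    · exact mul_nonneg hw (hg.nonneg _ _ _ hh (by linarith))
  have hnn2 : ∀ h, τ + h ≤ t → 0 ≤ (w + Δ) * g (n + 1) (τ + h) (w + a) := fun h hh =>
    mul_nonneg (by linarith) (hg.nonneg _ _ _ hh (by positivity))
  have hmul : Measurable fun h => ENNReal.ofReal (w * Real.exp (-(r * h))) *
      (if τ + h ≤ t then ENNReal.ofReal (g (n + 1) (τ + h) (w - a))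
        else ENNReal.ofReal (g n t w)) :=
    (Measurable.ennreal_ofReal (by fun_prop)).mul (hm _ hcont1)
  rw [← lintegral_add_left hmul, ← Ioc_union_Ioi_eq_Ioi hu, lintegral_union measurableSet_Ioi
      (disjoint_left.2 fun x hx hx' => not_lt.2 hx.2 hx'),
    setLIntegral_congr_fun (g := fun h => ENNReal.ofReal (ψ h)) measurableSet_Ioc,
    setLIntegral_congr_fun (s := Ioi (t - τ))
      (g := fun h => ENNReal.ofReal (r * Real.exp (-(r * h)) * g n t w)) measurableSet_Ioi,
    lintegral_Ioi_exp_mul hr0 hc]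
  -- By the backward equation, `-exp (-r h) g n (τ + h) w` is a primitive of the ring density `ψ`.
  -- Its boundary value at `t - τ` cancels the contribution of no ring before `t`.
  · have hder : ∀ h ∈ uIcc 0 (t - τ),
        HasDerivAt (fun h => -(Real.exp (-(r * h)) * g n (τ + h) w)) (ψ h) h := fun h _ => by
      have h1 : HasDerivAt (fun h => Real.exp (-(r * h))) (Real.exp (-(r * h)) * -(r * 1)) h :=
        ((hasDerivAt_id h).const_mul r).neg.exp
      have h2 := (hg.hasDerivAt n (τ + h) w).comp_const_add τ h
      refine (h1.mul h2).neg.congr_deriv ?_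
      simp only [hψ]
      ring
    have hI : ∫ h in Ioc 0 (t - τ), ψ h = g n τ w - Real.exp (-(r * (t - τ))) * g n t w := by
      rw [← intervalIntegral.integral_of_le hu,
        intervalIntegral.integral_eq_sub_of_hasDerivAt hder (hψc.intervalIntegrable _ _)]
      simp
      ring
    have hψ0 : ∀ h ∈ Ioc 0 (t - τ), 0 ≤ ψ h := fun h hh => by
      have hh' : τ + h ≤ t := by linarith [hh.2]
      exact mul_nonneg (Real.exp_pos _).le (add_nonneg (hnn2 h hh') (hnn1 h hh'))
    rw [← ofReal_integral_eq_lintegral_ofReal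
      ((hψc.integrableOn_Icc (a := 0) (b := t - τ)).mono_set Ioc_subset_Icc_self)
      ((ae_restrict_iff' measurableSet_Ioc).2 (Eventually.of_forall hψ0)),
      ← ENNReal.ofReal_add (setIntegral_nonneg measurableSet_Ioc hψ0) (by positivity), hI]
    congr 1
    ring
  · intro h hh
    have hh' : ¬ τ + h ≤ t := by have := mem_Ioi.1 hh; linarith
    simp only [if_neg hh']
    rw [← add_mul, ← ENNReal.ofReal_add (by positivity) (by positivity),
      ← ENNReal.ofReal_mul (by positivity)]
    congr 1
    rw [hr]
    ring
  · intro h hh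
    have hh' : τ + h ≤ t := by linarith [hh.2]
    simp only [if_pos hh']
    rw [← ENNReal.ofReal_mul (by positivity), ← ENNReal.ofReal_mul (by positivity),
      ← ENNReal.ofReal_add]
    · congr 1
      simp only [hψ]
      ring
    · rw [mul_right_comm]
      exact mul_nonneg (hnn1 h hh') (Real.exp_pos _).le
    · rw [mul_right_comm]
      exact mul_nonneg (hnn2 h hh') (Real.exp_pos _).le

end IsBackwardSolution

/-! ### Explicit solutions: number of draws, mean and centered second moment. -/

/-- The total rate `2w + Δ` has drift `2aΔ`; integrating its mean from `s` to `t` gives the expected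
number of further draws. -/
lemma isBackwardSolution_drawCount (a : ℕ) {Δ : ℤ} (hΔ : 0 < Δ) (t : ℝ) :
    IsBackwardSolution a Δ t fun n s w => n + (2 * w + Δ) * (t - s) + a * Δ * (t - s) ^ 2 where
  hasDerivAt n s w := by
    have h : HasDerivAt (fun s : ℝ => t - s) (-1) s := (hasDerivAt_id s).const_sub t
    refine HasDerivAt.congr_deriv (((h.const_mul (2 * w + Δ)).const_add (n : ℝ)).add
      ((h.pow 2).const_mul (a * Δ : ℝ))) ?_
    push_cast
    ring
  nonneg n s w hs hw := by
    have : (0 : ℝ) < Δ := by exact_mod_cast hΔ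
    have : 0 ≤ t - s := by linarith
    positivity

lemma isBackwardSolution_mean (a : ℕ) {Δ : ℤ} (hΔ : 0 < Δ) (t : ℝ) :
    IsBackwardSolution a Δ t fun _ s w => w + a * Δ * (t - s) where
  hasDerivAt n s w := by
    have h : HasDerivAt (fun s : ℝ => t - s) (-1) s := (hasDerivAt_id s).const_sub t
    refine HasDerivAt.congr_deriv ((h.const_mul (a * Δ : ℝ)).const_add w) ?_
    ring
  nonneg n s w hs hw := by
    have : (0 : ℝ) < Δ := by exact_mod_cast hΔ
    have : 0 ≤ t - s := by linarith
    positivity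

/-- Along the chain `(w - aΔs)²` grows at mean rate `a²(2w + Δ)`, the drift being compensated. The
correction terms are the integral of the mean of this rate from `s` to `t`. -/
lemma isBackwardSolution_sq (a : ℕ) {Δ : ℤ} (hΔ : 0 < Δ) (t : ℝ) :
    IsBackwardSolution a Δ t fun _ s w =>
      (w - a * Δ * s) ^ 2 + a ^ 3 * Δ * (t - s) ^ 2 + a ^ 2 * (2 * w + Δ) * (t - s) where
  hasDerivAt n s w := by
    have h : HasDerivAt (fun s : ℝ => t - s) (-1) s := (hasDerivAt_id s).const_sub t
    have h' : HasDerivAt (fun s : ℝ => w - a * Δ * s) (-(a * Δ * 1)) s :=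
      ((hasDerivAt_id s).const_mul (a * Δ : ℝ)).const_sub w
    refine HasDerivAt.congr_deriv (((h'.pow 2).add ((h.pow 2).const_mul (a ^ 3 * Δ : ℝ))).add
      (h.const_mul (a ^ 2 * (2 * w + Δ) : ℝ))) ?_
    push_cast
    ring
  nonneg n s w hs hw := by
    have : (0 : ℝ) < Δ := by exact_mod_cast hΔ
    have : 0 ≤ t - s := by linarith
    positivity

/-! ### Telescoping along the epochs, non-explosion and moment bounds. -/

lemma Reachable.blue_sub_white {a : ℕ} {x₀ x : Comp} (hx : Reachable (constDiffMatrix a) x₀ x) :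
    x 1 - x 0 = x₀ 1 - x₀ 0 := by
  induction hx with
  | start => rfl
  | draw x i _ _ ih =>
    rw [← ih]
    fin_cases i <;> simp [constDiffMatrix]

lemma Tenable.white_eq_zero_or_le {a : ℕ} {x₀ x : Comp} (h : Tenable (constDiffMatrix a) x₀)
    (hx : Reachable (constDiffMatrix a) x₀ x) : x 0 = 0 ∨ (a : ℤ) ≤ x 0 := by
  rcases ((h x hx).1 0).eq_or_lt with h0 | h0
  · exact Or.inl h0.symm
  · have := (h _ (hx.draw x 0 h0)).1 0
    simp [constDiffMatrix] at this
    exact Or.inr this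

namespace IsDrivenBy

variable {Ω : Type*} [MeasurableSpace Ω] {μ : Measure Ω} {a : ℕ} {x₀ : Comp} {C : ℕ → Ω → Fin 2}
  {H : ℕ → Ω → ℝ} {X : ℝ≥0 → Ω → Comp} {t : ℝ} {g : ℕ → ℝ → ℝ → ℝ}

/-- Averages `lintegral_step` over the past: either the next epoch comes by time `t`, or `t` falls
before it and the terminal value is collected. -/
lemma lintegral_epoch_step [IsFiniteMeasure μ] (hX : IsDrivenBy (constDiffMatrix a) x₀ μ C H X)
    (hten : Tenable (constDiffMatrix a) x₀) (hΔ : 0 < x₀ 1 - x₀ 0)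
    (hg : IsBackwardSolution a (x₀ 1 - x₀ 0) t g) (n : ℕ) :
    (∫⁻ ω, (if epoch H (n + 1) ω ≤ t then ENNReal.ofReal
        (g (n + 1) (epoch H (n + 1) ω) (compAfter (constDiffMatrix a) x₀ C (n + 1) ω 0))
          else 0) ∂μ) +
      (∫⁻ ω, (if epoch H n ω ≤ t ∧ t < epoch H (n + 1) ω then ENNReal.ofReal
        (g n t (compAfter (constDiffMatrix a) x₀ C n ω 0)) else 0) ∂μ) ≤
      ∫⁻ ω, (if epoch H n ω ≤ t then ENNReal.ofReal
        (g n (epoch H n ω) (compAfter (constDiffMatrix a) x₀ C n ω 0)) else 0) ∂μ := by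
  set A := constDiffMatrix a with hA
  have hTm := hX.measurable_epoch
  have hZm := hX.measurable_compAfter
  set Φ : Comp → ℝ → Fin 2 → ℝ → ℝ≥0∞ := fun z τ i h =>
    if τ + h ≤ t then ENNReal.ofReal (g (n + 1) (τ + h) ((z + A i) 0 : ℤ))
      else if τ ≤ t then ENNReal.ofReal (g n t (z 0)) else 0 with hΦ
  have hΦm : ∀ z i, Measurable fun p : ℝ × ℝ => Φ z p.1 i p.2 := fun z i =>
    hg.measurable_ite n _ _
  have hterm : Measurable fun ω => if epoch H n ω ≤ t ∧ t < epoch H (n + 1) ω then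
      ENNReal.ofReal (g n t (compAfter A x₀ C n ω 0)) else 0 := by
    refine Measurable.ite ((measurableSet_le (hTm n) measurable_const).inter
      (measurableSet_lt measurable_const (hTm (n + 1)))) ?_ measurable_const
    exact (measurable_of_countable fun z : Comp => ENNReal.ofReal (g n t (z 0))).comp (hZm n)
  rw [← lintegral_add_right _ hterm]
  have hpt : ∀ ω, ((if epoch H (n + 1) ω ≤ t then ENNReal.ofReal
        (g (n + 1) (epoch H (n + 1) ω) (compAfter A x₀ C (n + 1) ω 0)) else 0) +
      (if epoch H n ω ≤ t ∧ t < epoch H (n + 1) ω then ENNReal.ofReal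
        (g n t (compAfter A x₀ C n ω 0)) else 0)) =
      Φ (compAfter A x₀ C n ω) (epoch H n ω) (C n ω) (H n ω) := fun ω => by
    simp only [hΦ, epoch_succ, compAfter_succ]
    by_cases h1 : epoch H n ω + H n ω ≤ t
    · simp [h1, not_lt.2 h1]
    · simp [h1, not_le.1 h1]
  rw [lintegral_congr hpt, hX.lintegral_draw n hΦm]
  refine lintegral_mono_ae ?_
  filter_upwards [hX.ae_reachable n] with ω hω
  set z := compAfter A x₀ C n ω
  set τ := epoch H n ω
  have hz := (hten z hω).1
  have hz0 : ((z 0).toNat : ℝ) = z 0 := by exact_mod_cast Int.toNat_of_nonneg (hz 0)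
  have hz1 : ((z 1).toNat : ℝ) = z 0 + (x₀ 1 - x₀ 0 : ℤ) := by
    rw [← hω.blue_sub_white]
    push_cast
    have : ((z 1).toNat : ℝ) = z 1 := by exact_mod_cast Int.toNat_of_nonneg (hz 1)
    rw [this]
    ring
  have hΦh : ∀ i, Measurable fun h => Φ z τ i h := fun i =>
    (hΦm z i).comp (measurable_const.prodMk measurable_id)
  have hr : ((z 0).toNat + (z 1).toNat : ℝ) = 2 * z 0 + (x₀ 1 - x₀ 0 : ℤ) := by
    rw [hz0, hz1]; ring
  by_cases hτ : τ ≤ t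
  · rw [if_pos hτ, Fin.sum_univ_two, lintegral_ringMeasure _ _ (hΦh 0),
      lintegral_ringMeasure _ _ (hΦh 1), hr, hz0, hz1,
      ← hg.lintegral_step n hτ (w := z 0) (by exact_mod_cast hz 0)
        (by exact_mod_cast hten.white_eq_zero_or_le hω) hΔ]
    simp [hΦ, hτ, hA, constDiffMatrix, sub_eq_add_neg]
  -- Interarrival times are positive under `ringMeasure`, so an epoch past `t` is followed only by
  -- epochs past `t`.
  · rw [if_neg hτ]
    refine (Finset.sum_eq_zero fun i _ => ?_).le
    rw [lintegral_ringMeasure _ _ (hΦh i),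
      setLIntegral_congr_fun (g := fun _ => 0) measurableSet_Ioi, lintegral_zero]
    intro h hh
    have : ¬ τ + h ≤ t := by have := mem_Ioi.1 hh; linarith
    simp [hΦ, hτ, this]

lemma lintegral_epoch_add_sum_le [IsProbabilityMeasure μ]
    (hX : IsDrivenBy (constDiffMatrix a) x₀ μ C H X)
    (hten : Tenable (constDiffMatrix a) x₀) (hΔ : 0 < x₀ 1 - x₀ 0) (ht : 0 ≤ t)
    (hg : IsBackwardSolution a (x₀ 1 - x₀ 0) t g) (n : ℕ) :
    (∫⁻ ω, (if epoch H n ω ≤ t then ENNReal.ofReal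
        (g n (epoch H n ω) (compAfter (constDiffMatrix a) x₀ C n ω 0)) else 0) ∂μ) +
      ∑ k ∈ Finset.range n, (∫⁻ ω, (if epoch H k ω ≤ t ∧ t < epoch H (k + 1) ω then
        ENNReal.ofReal (g k t (compAfter (constDiffMatrix a) x₀ C k ω 0)) else 0) ∂μ) ≤
      ENNReal.ofReal (g 0 0 (x₀ 0)) := by
  induction n with
  | zero => simp [epoch, compAfter, ht]
  | succ n ih =>
    refine le_trans ?_ ih
    rw [Finset.sum_range_succ, add_comm (Finset.sum _ _), ← add_assoc]
    gcongr
    exact hX.lintegral_epoch_step hten hΔ hg n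

/-- The urn does not explode: almost surely the epochs exceed `t`. -/
lemma ae_exists_lt_epoch [IsProbabilityMeasure μ]
    (hX : IsDrivenBy (constDiffMatrix a) x₀ μ C H X)
    (hten : Tenable (constDiffMatrix a) x₀) (hΔ : 0 < x₀ 1 - x₀ 0) (ht : 0 ≤ t) :
    ∀ᵐ ω ∂μ, ∃ n, t < epoch H n ω := by
  have hg := isBackwardSolution_drawCount a hΔ t
  have hΔ' : (0 : ℝ) < (x₀ 1 - x₀ 0 : ℤ) := by exact_mod_cast hΔ
  set K : ℝ≥0∞ := ENNReal.ofReal ((0 : ℕ) + (2 * x₀ 0 + (x₀ 1 - x₀ 0 : ℤ)) * (t - 0) +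
    a * (x₀ 1 - x₀ 0 : ℤ) * (t - 0) ^ 2) with hK
  -- On the explosion event every epoch is at most `t`, so the first term of the telescoped bound is
  -- at least `n` there, while `K` does not depend on `n`.
  have hbound : ∀ n : ℕ, n * μ {ω | ∀ n, epoch H n ω ≤ t} ≤ K := fun n => by
    refine le_trans ?_ (le_self_add.trans (hX.lintegral_epoch_add_sum_le hten hΔ ht hg n))
    refine le_trans ?_ (lintegral_mono_ae (f := {ω | ∀ n, epoch H n ω ≤ t}.indicator
      fun _ => (n : ℝ≥0∞)) ?_)
    · rw [lintegral_indicator_const]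
      simp only [ofPred_forall]
      exact MeasurableSet.iInter fun k =>
        measurableSet_le (hX.measurable_epoch k) measurable_const
    · filter_upwards [hX.ae_reachable n] with ω hω
      by_cases h : ∀ n, epoch H n ω ≤ t
      · rw [indicator_of_mem (by exact h), if_pos (h n), ← ENNReal.ofReal_natCast]
        refine ENNReal.ofReal_le_ofReal ?_
        have h0 : (0 : ℝ) ≤ compAfter (constDiffMatrix a) x₀ C n ω 0 := by
          exact_mod_cast (hten _ hω).1 0
        have hs : 0 ≤ t - epoch H n ω := sub_nonneg.2 (h n)
        rw [add_assoc]
        exact le_add_of_nonneg_right (by positivity)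
      · rw [indicator_of_notMem (by exact h)]
        exact zero_le
  have hzero : μ {ω | ∀ n, epoch H n ω ≤ t} = 0 := by
    by_contra hne
    obtain ⟨n, hn⟩ := ENNReal.exists_nat_mul_gt hne (ENNReal.ofReal_ne_top : K ≠ ⊤)
    exact absurd (hbound n) (not_le.2 hn)
  rw [ae_iff]
  simpa only [not_exists, not_lt] using hzero

/-- Almost surely the process at time `t` is the composition after finitely many draws. -/
lemma ae_nonneg_white [IsProbabilityMeasure μ]
    (hX : IsDrivenBy (constDiffMatrix a) x₀ μ C H X)
    (hten : Tenable (constDiffMatrix a) x₀) (hΔ : 0 < x₀ 1 - x₀ 0) (t : ℝ≥0) :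
    ∀ᵐ ω ∂μ, 0 ≤ X t ω 0 ∧ ∃ k, epoch H k ω ≤ t ∧ (t : ℝ) < epoch H (k + 1) ω ∧
      X t ω = compAfter (constDiffMatrix a) x₀ C k ω := by
  filter_upwards [hX.ae_exists_lt_epoch hten hΔ t.2, hX.path,
    ae_all_iff.2 hX.ae_reachable] with ω hex hpath hreach
  classical
  -- The first epoch past `t` is not number `0`, since `epoch H 0 = 0 ≤ t`; its predecessor opens
  -- the interval containing `t`.
  obtain ⟨k, hk⟩ : ∃ k, Nat.find hex = k + 1 := by
    refine Nat.exists_eq_succ_of_ne_zero fun h => ?_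
    have h1 := Nat.find_spec hex
    rw [h] at h1
    simp only [epoch, Finset.range_zero, Finset.sum_empty] at h1
    exact absurd t.2 (not_le.2 h1)
  have h1 : (t : ℝ) < epoch H (k + 1) ω := hk ▸ Nat.find_spec hex
  have h2 : epoch H k ω ≤ t := not_lt.1 (Nat.find_min hex (by omega))
  have h3 := hpath k t h2 h1
  exact ⟨h3 ▸ (hten _ (hreach k)).1 0, k, h2, h1, h3⟩

/-- The mean of a terminal value is at most the value at time `0` of its backward solution. -/
lemma lintegral_white_le [IsProbabilityMeasure μ]
    (hX : IsDrivenBy (constDiffMatrix a) x₀ μ C H X)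
    (hten : Tenable (constDiffMatrix a) x₀) (hΔ : 0 < x₀ 1 - x₀ 0) (t : ℝ≥0) {F : ℝ → ℝ}
    (hg : IsBackwardSolution a (x₀ 1 - x₀ 0) t g) (hF : ∀ n w, g n t w = F w) :
    ∫⁻ ω, ENNReal.ofReal (F (X t ω 0)) ∂μ ≤ ENNReal.ofReal (g 0 0 (x₀ 0)) := by
  have hm : ∀ k, Measurable fun ω => if epoch H k ω ≤ t ∧ (t : ℝ) < epoch H (k + 1) ω then
      ENNReal.ofReal (g k t (compAfter (constDiffMatrix a) x₀ C k ω 0)) else 0 := fun k => by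
    refine Measurable.ite ((measurableSet_le (hX.measurable_epoch k) measurable_const).inter
      (measurableSet_lt measurable_const (hX.measurable_epoch (k + 1)))) ?_ measurable_const
    exact (measurable_of_countable fun z : Comp => ENNReal.ofReal (g k t (z 0))).comp
      (hX.measurable_compAfter k)
  calc ∫⁻ ω, ENNReal.ofReal (F (X t ω 0)) ∂μ
      ≤ ∫⁻ ω, ∑' k, (if epoch H k ω ≤ t ∧ (t : ℝ) < epoch H (k + 1) ω then
        ENNReal.ofReal (g k t (compAfter (constDiffMatrix a) x₀ C k ω 0)) else 0) ∂μ := by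
        refine lintegral_mono_ae ?_
        filter_upwards [hX.ae_nonneg_white hten hΔ t] with ω ⟨_, k, h1, h2, h3⟩
        refine le_trans ?_ (ENNReal.le_tsum k)
        rw [if_pos ⟨h1, h2⟩, hF, h3]
    _ = ∑' k, ∫⁻ ω, (if epoch H k ω ≤ t ∧ (t : ℝ) < epoch H (k + 1) ω then
        ENNReal.ofReal (g k t (compAfter (constDiffMatrix a) x₀ C k ω 0)) else 0) ∂μ :=
        lintegral_tsum fun k => (hm k).aemeasurable
    _ ≤ ENNReal.ofReal (g 0 0 (x₀ 0)) := by
        -- Each partial sum is bounded by dropping the nonnegative term for the `n`-th epoch from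
        -- the telescoped bound.
        rw [ENNReal.tsum_eq_iSup_nat]
        exact iSup_le fun n =>
          le_add_self.trans (hX.lintegral_epoch_add_sum_le hten hΔ t.2 hg n)

end IsDrivenBy

/-! ### From moments to the error bound. -/

lemma integrable_and_integral_le_of_lintegral_le {Ω : Type*} [MeasurableSpace Ω] {μ : Measure Ω}
    {f : Ω → ℝ} {c : ℝ} (hf : Measurable f) (hf0 : 0 ≤ᵐ[μ] f) (hc : 0 ≤ c)
    (h : ∫⁻ ω, ENNReal.ofReal (f ω) ∂μ ≤ ENNReal.ofReal c) :
    Integrable f μ ∧ ∫ ω, f ω ∂μ ≤ c := by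
  refine ⟨⟨hf.aestronglyMeasurable, ?_⟩, ?_⟩
  · rw [hasFiniteIntegral_iff_ofReal hf0]
    exact h.trans_lt ENNReal.ofReal_lt_top
  · rw [integral_eq_lintegral_of_nonneg_ae hf0 hf.aestronglyMeasurable]
    exact ENNReal.toReal_le_of_le_ofReal hc h

lemma sq_integral_le_integral_sq {Ω : Type*} [MeasurableSpace Ω] {μ : Measure Ω}
    [IsProbabilityMeasure μ] {f : Ω → ℝ} (hf : Measurable f)
    (hf2 : Integrable (fun ω => f ω ^ 2) μ) : (∫ ω, f ω ∂μ) ^ 2 ≤ ∫ ω, f ω ^ 2 ∂μ := by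
  have h := variance_nonneg f μ
  rw [variance_eq_sub ((memLp_two_iff_integrable_sq hf.aestronglyMeasurable).2 hf2)] at h
  simpa using h

/-- The algebra behind the error bound when `a < 4 Δ`. -/
lemma second_moment_le_sq {a Δ w t : ℝ} (ha : 0 ≤ a) (hΔ : 0 ≤ Δ) (hw : 0 ≤ w) (ht : 0 < t)
    (haΔ : a ≤ 4 * Δ) :
    (w ^ 2 + a ^ 3 * Δ * t ^ 2 + a ^ 2 * (2 * w + Δ) * t) / t ^ 2 ≤
      (Real.sqrt (a ^ 3 * Δ + a ^ 2 * (w + Δ) / t) + w / t) ^ 2 := by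
  have h0 : 0 ≤ a ^ 3 * Δ + a ^ 2 * (w + Δ) / t := by positivity
  set S := Real.sqrt (a ^ 3 * Δ + a ^ 2 * (w + Δ) / t) with hS
  have hS2 : S ^ 2 = a ^ 3 * Δ + a ^ 2 * (w + Δ) / t := Real.sq_sqrt h0
  -- After matching `S²` and `(w/t)²`, the second moment leaves `a² w/t`; the cross term `2 S w/t`
  -- absorbs it exactly when `S ≥ a²/2` (or `w = 0`), and `a³Δ ≥ a⁴/4` ensures this.
  have haS : a ^ 2 / 2 ≤ S := by
    refine Real.le_sqrt_of_sq_le ?_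
    have h1 : a ^ 3 * a ≤ a ^ 3 * (4 * Δ) := mul_le_mul_of_nonneg_left haΔ (by positivity)
    have h2 : 0 ≤ a ^ 2 * (w + Δ) / t := by positivity
    nlinarith
  have h3 : a ^ 2 / 2 * (w / t) ≤ S * (w / t) := mul_le_mul_of_nonneg_right haS (by positivity)
  have h4 : (w ^ 2 + a ^ 3 * Δ * t ^ 2 + a ^ 2 * (2 * w + Δ) * t) / t ^ 2 =
      (w / t) ^ 2 + (a ^ 3 * Δ + a ^ 2 * (w + Δ) / t) + 2 * (a ^ 2 / 2 * (w / t)) := by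
    field_simp
    ring
  rw [h4, ← hS2]
  linarith [add_sq S (w / t)]

lemma two_mul_le_sqrt {a Δ c : ℝ} (hΔ : 0 ≤ Δ) (hc : 0 ≤ c) (haΔ : 4 * Δ ≤ a) :
    2 * (a * Δ) ≤ Real.sqrt (a ^ 3 * Δ + c) := by
  refine Real.le_sqrt_of_sq_le ?_
  have : a ^ 2 * Δ * (4 * Δ) ≤ a ^ 2 * Δ * a := mul_le_mul_of_nonneg_left haΔ (by positivity)
  nlinarith

/-- The error bound at a fixed time. For `a ≤ 4 Δ` it follows from the second moment, otherwise
from the first one. -/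
lemma IsDrivenBy.integral_abs_sub_le {Ω : Type*} [MeasurableSpace Ω] {μ : Measure Ω}
    [IsProbabilityMeasure μ] {a : ℕ} {x₀ : Comp} {C : ℕ → Ω → Fin 2} {H : ℕ → Ω → ℝ}
    {X : ℝ≥0 → Ω → Comp} (hX : IsDrivenBy (constDiffMatrix a) x₀ μ C H X)
    (hten : Tenable (constDiffMatrix a) x₀) {Δ : ℤ} (hΔ : Δ = x₀ 1 - x₀ 0) (hΔ0 : 0 < Δ)
    {t : ℝ≥0} (ht : 0 < t) :
    Integrable (fun ω => |(X t ω 0 : ℝ) / t - a * Δ|) μ ∧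
      ∫ ω, |(X t ω 0 : ℝ) / t - a * Δ| ∂μ ≤
        Real.sqrt ((a : ℝ) ^ 3 * Δ + (a : ℝ) ^ 2 * (x₀ 0 + Δ) / t) + x₀ 0 / t := by
  subst hΔ
  have hmean := hX.lintegral_white_le hten hΔ0 t (F := fun w => w)
    (isBackwardSolution_mean a hΔ0 t) (by simp)
  have hsq := hX.lintegral_white_le hten hΔ0 t
    (F := fun w => (w - a * (x₀ 1 - x₀ 0 : ℤ) * t) ^ 2) (isBackwardSolution_sq a hΔ0 t) (by simp)
  have hw : (0 : ℝ) ≤ x₀ 0 := by exact_mod_cast (hten _ .start).1 0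
  set Δ := x₀ 1 - x₀ 0
  have hΔ : (0 : ℝ) < Δ := by exact_mod_cast hΔ0
  have htr : (0 : ℝ) < t := ht
  set w : ℝ := ((x₀ 0 : ℤ) : ℝ)
  have hXm : Measurable fun ω => (X t ω 0 : ℝ) :=
    (measurable_of_countable fun z : Comp => (z 0 : ℝ)).comp (hX.measurable_process t)
  have hX0 : ∀ᵐ ω ∂μ, (0 : ℝ) ≤ X t ω 0 := by
    filter_upwards [hX.ae_nonneg_white hten hΔ0 t] with ω hω
    exact_mod_cast hω.1
  obtain ⟨hint, hmean⟩ := integrable_and_integral_le_of_lintegral_le hXm hX0 (by positivity) hmean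
  obtain ⟨hint2, hsq⟩ := integrable_and_integral_le_of_lintegral_le
    (f := fun ω => ((X t ω 0 : ℝ) - a * Δ * t) ^ 2) (by fun_prop)
    (Eventually.of_forall fun ω => sq_nonneg _) (by
      rw [sub_zero]
      positivity) hsq
  have hintY : Integrable (fun ω => |(X t ω 0 : ℝ) / t - a * Δ|) μ :=
    ((hint.div_const _).sub (integrable_const _)).abs
  refine ⟨hintY, ?_⟩
  rcases le_total (a : ℝ) (4 * Δ) with haΔ | haΔ
  · have hYsq : (fun ω => |(X t ω 0 : ℝ) / t - a * Δ| ^ 2) =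
        fun ω => ((X t ω 0 : ℝ) - a * Δ * t) ^ 2 / (t : ℝ) ^ 2 := by
      funext ω
      rw [sq_abs, ← div_pow]
      congr 1
      field_simp
    refine (pow_le_pow_iff_left₀ (integral_nonneg fun ω => abs_nonneg _) (by positivity)
      two_ne_zero).1 ?_
    refine (sq_integral_le_integral_sq (by fun_prop) ?_).trans ?_
    · rw [hYsq]
      exact hint2.div_const _
    · rw [hYsq, integral_div]
      refine le_trans ?_ (second_moment_le_sq (Nat.cast_nonneg a) hΔ.le hw htr haΔ)
      refine div_le_div_of_nonneg_right (hsq.trans_eq ?_) (by positivity)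
      ring
  -- For large `a` no cancellation is needed: the mean of `W/t + aΔ` is at most `2aΔ + w/t`, and
  -- `2aΔ` is below the square root.
  · calc ∫ ω, |(X t ω 0 : ℝ) / t - a * Δ| ∂μ
        ≤ ∫ ω, ((X t ω 0 : ℝ) / t + a * Δ) ∂μ := by
          refine integral_mono_ae hintY ((hint.div_const _).add (integrable_const _)) ?_
          filter_upwards [hX0] with ω hω
          have h1 : (0 : ℝ) ≤ X t ω 0 / t := by positivity
          have h2 : (0 : ℝ) ≤ a * Δ := by positivity
          exact abs_le.2 ⟨by linarith, by linarith⟩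
      _ = (∫ ω, (X t ω 0 : ℝ) ∂μ) / t + a * Δ := by
          rw [integral_add (hint.div_const _) (integrable_const _), integral_div]
          simp
      _ ≤ (w + a * Δ * (t - 0)) / t + a * Δ := by gcongr
      _ = 2 * (a * Δ) + w / t := by
          field_simp
          ring
      _ ≤ _ := by
          gcongr
          exact two_mul_le_sqrt hΔ.le (by positivity) haΔ

end PolyaUrn

theorem mainTheorem5 {Ω : Type*} [MeasurableSpace Ω] (μ : Measure Ω) [IsProbabilityMeasure μ]
    (a w₀ b₀ : ℕ) (ha : 1 ≤ a) (Δ : ℤ) (hΔ : Δ = (b₀ : ℤ) - (w₀ : ℤ)) (hΔ1 : 1 ≤ Δ)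
    (hten : PolyaUrn.Tenable (PolyaUrn.constDiffMatrix a) ![(w₀ : ℤ), (b₀ : ℤ)])
    (X : ℝ≥0 → Ω → PolyaUrn.Comp)
    (hX : PolyaUrn.IsPolyaProcess (PolyaUrn.constDiffMatrix a) ![(w₀ : ℤ), (b₀ : ℤ)] μ X)
    (W : ℝ≥0 → Ω → ℝ) (hW : ∀ t ω, W t ω = (X t ω 0 : ℝ)) :
    (∀ t : ℝ≥0, 0 < t →
      Integrable (fun ω => |W t ω / (t : ℝ) - (a : ℝ) * (Δ : ℝ)|) μ ∧
      ∫ ω, |W t ω / (t : ℝ) - (a : ℝ) * (Δ : ℝ)| ∂μ ≤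
        Real.sqrt ((a : ℝ) ^ 3 * (Δ : ℝ) + (a : ℝ) ^ 2 * ((w₀ : ℝ) + (Δ : ℝ)) / (t : ℝ))
          + (w₀ : ℝ) / (t : ℝ)) ∧
    (∃ M : ℝ, ∀ᶠ t : ℝ≥0 in atTop, ∫ ω, |W t ω / (t : ℝ) - (a : ℝ) * (Δ : ℝ)| ∂μ ≤ M) := by
  obtain ⟨C, H, hX⟩ := hX
  have hbound : ∀ t : ℝ≥0, 0 < t →
      Integrable (fun ω => |W t ω / (t : ℝ) - (a : ℝ) * (Δ : ℝ)|) μ ∧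
      ∫ ω, |W t ω / (t : ℝ) - (a : ℝ) * (Δ : ℝ)| ∂μ ≤
        Real.sqrt ((a : ℝ) ^ 3 * (Δ : ℝ) + (a : ℝ) ^ 2 * ((w₀ : ℝ) + (Δ : ℝ)) / (t : ℝ))
          + (w₀ : ℝ) / (t : ℝ) := fun t ht => by
    simpa [hW] using hX.integral_abs_sub_le hten (Δ := Δ) (by simpa using hΔ) (by omega) ht
  -- `M` is the bound at `t = 1`; the bound decreases in `t`.
  refine ⟨hbound, Real.sqrt ((a : ℝ) ^ 3 * Δ + (a : ℝ) ^ 2 * (w₀ + Δ)) + w₀, ?_⟩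
  filter_upwards [eventually_ge_atTop 1] with t ht
  have ht' : (1 : ℝ) ≤ t := ht
  have hΔ0 : (0 : ℝ) ≤ Δ := by exact_mod_cast (by omega : 0 ≤ Δ)
  refine (hbound t (one_pos.trans_le ht)).2.trans ?_
  gcongr
  · exact div_le_self (by positivity) ht'
  · exact div_le_self (by positivity) ht'
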